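/- Let $\mathcal H$ be a separable complex Hilbert space. A propagator on $\mathcal H$ is a family of unitary operators $U(t,s)$, $t,s\in\mathbb R$, on $\mathcal H$ such that $(t,s)\mapsto U(t,s)\psi$ is continuous on $\mathbb R^2$ for every $\psi\in\mathcal H$ and $U(t,r)U(r,s)=U(t,s)$ for all $t,s,r\in\mathbb R$. Its quasi-energy operator $K$ is the generator in $\mathcal K=L^2(\mathbb R,\mathcal H,dt)$ of the one-parameter unitary group $(e^{-i\sigma K}f)(t)=U(t,t-\sigma)f(t-\sigma)$, $\sigma\in\mathbb R$; that is, $\operatorname{Dom}K$ consists of those $f\in\mathcal K$ for which $Kf=\lim_{\sigma\to0}\frac{i}{\sigma}\left(e^{-i\sigma K}f-f\right)$ exists in $\mathcal K$. For an operator $K$ in $\mathcal K$, the generalized kernel is $$\operatorname{Ker}_0K=\{f\in L^2_{\mathrm{loc}}(\mathbb R,\mathcal H,dt):\ \forall\eta\in C_0^\infty(\mathbb R),\ \eta f\in\operatorname{Dom}K\text{ and }K(\eta f)=-i\eta' f\},$$ where functions that are equal almost everywhere are identified. (a) For every propagator $U$ on $\mathcal H$ with quasi-energy operator $K$, $$\operatorname{Ker}_0K=\{\,t\mapsto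 U(t,0)\psi:\ \psi\in\mathcal H\,\}.$$ (b) The correspondence between propagators and quasi-energy operators is one-to-one: if two propagators $U$ and $U_1$ on $\mathcal H$ have equal quasi-energy operators, $K=K_1$, then $U(t,s)=U_1(t,s)$ for all $t,s\in\mathbb R$. -/

import Mathlib

open MeasureTheory Filter Topology

noncomputable section

/-- A propagator on `H`: a family of unitary operators `U(t,s)`, `t, s ∈ ℝ`, that is jointly
strongly continuous and satisfies the Chapman-Kolmogorov equality. -/
@[ext]
structure Propagator (H : Type*) [NormedAddCommGroup H] [InnerProductSpace ℂ H] where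
  op : ℝ → ℝ → (H ≃ₗᵢ[ℂ] H)
  strong_cont : ∀ ψ : H, Continuous fun p : ℝ × ℝ => op p.1 p.2 ψ
  chapman_kolmogorov : ∀ (t s r : ℝ) (ψ : H), op t r (op r s ψ) = op t s ψ

/-- The generator `A` of a one-parameter family `T(σ) = exp(-iσA)`: its domain consists of the
vectors `f` for which `σ ↦ T(σ) f` has a derivative at `σ = 0` in the sense that
`lim_{σ → 0} (i/σ) (T(σ) f - f)` exists in norm, and `A f` is that limit. -/
def stoneGenerator {E : Type*} [NormedAddCommGroup E] [NormedSpace ℂ E]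
    (T : ℝ → (E →ₗᵢ[ℂ] E)) : E →ₗ.[ℂ] E where
  domain :=
    { carrier := {f | ∃ g : E,
        Tendsto (fun σ : ℝ => (Complex.I / (σ : ℂ)) • (T σ f - f)) (𝓝[≠] 0) (𝓝 g)}
      zero_mem' := ⟨0, by simp⟩
      add_mem' := by
        rintro f₁ f₂ ⟨g₁, h₁⟩ ⟨g₂, h₂⟩
        refine ⟨g₁ + g₂, (h₁.add h₂).congr fun σ => ?_⟩
        rw [map_add, ← smul_add]
        congr 1
        abel
      smul_mem' := by
        rintro c f ⟨g, h⟩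
        refine ⟨c • g, (h.const_smul c).congr fun σ => ?_⟩
        rw [map_smul, smul_comm, smul_sub] }
  toFun :=
    { toFun := fun f => f.2.choose
      map_add' := by
        intro f₁ f₂
        refine tendsto_nhds_unique (f₁ + f₂).2.choose_spec
          ((f₁.2.choose_spec.add f₂.2.choose_spec).congr fun σ => ?_)
        rw [Submodule.coe_add, map_add, ← smul_add]
        congr 1
        abel
      map_smul' := by
        intro c f
        refine tendsto_nhds_unique (c • f).2.choose_spec
          ((f.2.choose_spec.const_smul c).congr fun σ => ?_)
        rw [Submodule.coe_smul, map_smul, smul_comm, smul_sub] }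

namespace Propagator

variable {H : Type*} [NormedAddCommGroup H] [InnerProductSpace ℂ H]

theorem continuous_uncurry (U : Propagator H) :
    Continuous fun p : (ℝ × ℝ) × H => U.op p.1.1 p.1.2 p.2 := by
  rw [continuous_iff_continuousAt]
  rintro ⟨p₀, v₀⟩
  have h1 : Tendsto (fun p : (ℝ × ℝ) × H => U.op p.1.1 p.1.2 (p.2 - v₀))
      (𝓝 (p₀, v₀)) (𝓝 0) := by
    rw [tendsto_zero_iff_norm_tendsto_zero]
    simp only [LinearIsometryEquiv.norm_map]
    have : Continuous fun p : (ℝ × ℝ) × H => ‖p.2 - v₀‖ := by fun_prop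
    simpa using this.tendsto (p₀, v₀)
  have h2 : Tendsto (fun p : (ℝ × ℝ) × H => U.op p.1.1 p.1.2 v₀)
      (𝓝 (p₀, v₀)) (𝓝 (U.op p₀.1 p₀.2 v₀)) :=
    ((U.strong_cont v₀).comp continuous_fst).tendsto (p₀, v₀)
  have h3 := h1.add h2
  rw [zero_add] at h3
  exact h3.congr fun p => by rw [map_sub]; abel

theorem memLp_shift (U : Propagator H) (σ : ℝ) (f : Lp H 2 (volume : Measure ℝ)) :
    MemLp (fun t : ℝ => U.op t (t - σ) (f (t - σ))) 2 volume := by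
  have hf : MemLp (fun t : ℝ => f (t - σ)) 2 volume :=
    (Lp.memLp f).comp_measurePreserving (measurePreserving_sub_right volume σ)
  refine hf.of_le ?_ (Eventually.of_forall fun t => by simp)
  have hp : AEStronglyMeasurable (fun t : ℝ => (((t, t - σ) : ℝ × ℝ), f (t - σ))) volume :=
    AEStronglyMeasurable.prodMk
      (by fun_prop : Continuous fun t : ℝ => ((t, t - σ) : ℝ × ℝ)).aestronglyMeasurable hf.1
  exact U.continuous_uncurry.comp_aestronglyMeasurable hp

/-- The operators `exp(-iσK)` on `L²(ℝ, H, dt)`: the function `f` is sent to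
`t ↦ U(t, t-σ) f(t-σ)`. -/
def shiftGroup (U : Propagator H) (σ : ℝ) :
    Lp H 2 (volume : Measure ℝ) →ₗᵢ[ℂ] Lp H 2 (volume : Measure ℝ) where
  toFun f := (U.memLp_shift σ f).toLp _
  map_add' f g := by
    rw [← MemLp.toLp_add, MemLp.toLp_eq_toLp_iff]
    filter_upwards [(measurePreserving_sub_right volume σ).quasiMeasurePreserving.ae
      (Lp.coeFn_add f g)] with t ht
    simp only [Pi.add_apply] at ht ⊢
    rw [ht, map_add]
  map_smul' c f := by
    rw [RingHom.id_apply, ← MemLp.toLp_const_smul, MemLp.toLp_eq_toLp_iff]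
    filter_upwards [(measurePreserving_sub_right volume σ).quasiMeasurePreserving.ae
      (Lp.coeFn_smul c f)] with t ht
    simp only [Pi.smul_apply] at ht ⊢
    rw [ht, map_smul]
  norm_map' f := by
    change ‖(U.memLp_shift σ f).toLp _‖ = ‖f‖
    rw [Lp.norm_toLp, Lp.norm_def]
    congr 1
    rw [← eLpNorm_comp_measurePreserving (Lp.aestronglyMeasurable f)
      (measurePreserving_sub_right volume σ)]
    exact eLpNorm_congr_norm_ae (Eventually.of_forall fun t => by simp)

/-- The quasi-energy operator `K` of a propagator, as an unbounded operator in
`L²(ℝ, H, dt)`. -/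
def quasiEnergy (U : Propagator H) :
    Lp H 2 (volume : Measure ℝ) →ₗ.[ℂ] Lp H 2 (volume : Measure ℝ) :=
  stoneGenerator U.shiftGroup

/-- The function `t ↦ U(t,0) ψ`, up to equality almost everywhere. -/
def trajectory (U : Propagator H) (ψ : H) : ℝ →ₘ[(volume : Measure ℝ)] H :=
  AEEqFun.mk (fun t : ℝ => U.op t 0 ψ)
    ((U.strong_cont ψ).comp (Continuous.prodMk_left 0)).aestronglyMeasurable

end Propagator

/-- The space `L²_loc(ℝ, H, dt)` (of classes modulo equality almost everywhere). -/
def L2loc (H : Type*) [NormedAddCommGroup H] : Set (ℝ →ₘ[(volume : Measure ℝ)] H) :=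
  {f | ∀ S : Set ℝ, IsCompact S → MemLp f 2 (volume.restrict S)}

/-- The generalized kernel `Ker₀ K` of an unbounded operator `K` in `L²(ℝ, H, dt)`: all
`f ∈ L²_loc` such that for every test function `η` the function `η f` is in `Dom K` and
`K (η f) = -i η' f`. -/
def generalizedKernel {H : Type*} [NormedAddCommGroup H] [InnerProductSpace ℂ H]
    (K : Lp H 2 (volume : Measure ℝ) →ₗ.[ℂ] Lp H 2 (volume : Measure ℝ)) :
    Set (ℝ →ₘ[(volume : Measure ℝ)] H) :=
  {f | f ∈ L2loc H ∧
    ∀ η : ℝ → ℂ, ContDiff ℝ (⊤ : ℕ∞) η → HasCompactSupport η →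
      ∃ F : K.domain,
        ((F : Lp H 2 (volume : Measure ℝ)) : ℝ → H) =ᵐ[volume] (fun t => η t • f t) ∧
        (K F : ℝ → H) =ᵐ[volume] fun t => (-Complex.I * deriv η t) • f t}

end

/-! ### Test functions on the line. -/

open scoped ContDiff

/-! Pulling back by `g t = U(0,t) f(t)` turns `exp(-iσK)` into translation, so `K` acts as `-i
d/dt`, and `K(ηf) = -iη'f` for all `η` says that `g` has zero distributional derivative
(`integral_deriv_smul_pullback`). By du Bois-Reymond `g` is a constant `ψ`, so `f(t) = U(t,0)ψ`.
Conversely, on `η(t) U(t,0)ψ` the group only translates `η`, and Taylor's formula gives the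
generator.

Hence `K` determines the set of trajectories. Continuity and the value at time 0 then match them
individually, and `U(t,s) = U(t,0)U(0,s)` recovers the propagator. -/

/-- The primitive started left of the support vanishes to its right because the total integral is
zero. The bound `|R| + 1` also covers a negative `R` and gives the strict inequality in `hzero`. -/
theorem exists_contDiff_hasCompactSupport_deriv_eq {φ : ℝ → ℝ} (hφ : ContDiff ℝ ∞ φ)
    (hc : HasCompactSupport φ) (h0 : ∫ t, φ t = 0) :
    ∃ η : ℝ → ℝ, ContDiff ℝ ∞ η ∧ HasCompactSupport η ∧ deriv η = φ := by
  obtain ⟨R, hR⟩ := hc.isCompact.isBounded.subset_closedBall 0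
  have hzero : ∀ t, R < |t| → φ t = 0 := fun t ht => by
    by_contra h
    have := hR (subset_tsupport φ h)
    rw [mem_closedBall_zero_iff, Real.norm_eq_abs] at this
    linarith
  have hint : Integrable φ := hφ.continuous.integrable_of_hasCompactSupport hc
  have hd : ∀ t, HasDerivAt (fun t => ∫ x in (-(|R| + 1))..t, φ x) (φ t) t := fun t =>
    intervalIntegral.integral_hasDerivAt_right hint.intervalIntegrable
      (hφ.continuous.stronglyMeasurableAtFilter _ _) hφ.continuous.continuousAt
  have hderiv : deriv (fun t => ∫ x in (-(|R| + 1))..t, φ x) = φ := funext fun t => (hd t).deriv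
  refine ⟨fun t => ∫ x in (-(|R| + 1))..t, φ x, ?_, ?_, hderiv⟩
  · rw [contDiff_infty_iff_deriv, hderiv]
    exact ⟨fun t => (hd t).differentiableAt, hφ⟩
  · refine HasCompactSupport.intro (isCompact_Icc (a := -(|R| + 1)) (b := |R| + 1)) fun t ht => ?_
    have hlo : ∀ x ≤ -(|R| + 1), φ x = 0 := fun x hx => hzero x (by
      have := le_abs_self R
      have := neg_le_abs x
      linarith)
    have hhi : ∀ x, |R| + 1 ≤ x → φ x = 0 := fun x hx => hzero x (by
      have := le_abs_self R
      have := le_abs_self x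
      linarith)
    rw [Set.mem_Icc, not_and_or, not_le, not_le] at ht
    rcases ht with ht | ht
    · rw [intervalIntegral.integral_symm, intervalIntegral.integral_of_le ht.le,
        setIntegral_eq_zero_of_forall_eq_zero fun x hx => hlo x hx.2, neg_zero]
    · have hle : -(|R| + 1) ≤ t := by
        have := abs_nonneg R
        linarith
      rw [intervalIntegral.integral_of_le hle,
        setIntegral_eq_integral_of_forall_compl_eq_zero, h0]
      intro x hx
      rw [Set.mem_Ioc, not_and_or, not_lt, not_le] at hx
      exact hx.elim (hlo x) fun h => hhi x (ht.trans h).le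

/-- The du Bois-Reymond lemma: a locally integrable function on the line whose distributional
derivative vanishes is almost everywhere constant. -/
theorem ae_eq_const_of_integral_deriv_smul_eq_zero {E : Type*} [NormedAddCommGroup E]
    [NormedSpace ℝ E] [CompleteSpace E] {g : ℝ → E} (hg : LocallyIntegrable g)
    (h : ∀ η : ℝ → ℝ, ContDiff ℝ ∞ η → HasCompactSupport η → ∫ t, deriv η t • g t = 0) :
    ∃ c : E, g =ᵐ[volume] fun _ => c := by
  let b : ContDiffBump (0 : ℝ) := default
  let ρ : ℝ → ℝ := b.normed volume
  have hρ : ContDiff ℝ ∞ ρ := b.contDiff_normed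
  have hρc : HasCompactSupport ρ := b.hasCompactSupport_normed
  have hρ1 : ∫ t, ρ t = 1 := b.integral_normed
  have hint : ∀ φ : ℝ → ℝ, ContDiff ℝ ∞ φ → HasCompactSupport φ → Integrable φ :=
    fun φ h1 h2 => h1.continuous.integrable_of_hasCompactSupport h2
  have hintg : ∀ φ : ℝ → ℝ, ContDiff ℝ ∞ φ → HasCompactSupport φ →
      Integrable fun t => φ t • g t :=
    fun φ h1 h2 => hg.integrable_smul_left_of_hasCompactSupport h1.continuous h2
  have hρg : ∀ a : ℝ, Integrable fun t => a • ρ t • g t := fun a => (hintg ρ hρ hρc).smul a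
  refine ⟨∫ t, ρ t • g t, ?_⟩
  set c := ∫ t, ρ t • g t
  have key : ∀ᵐ t, g t - c = 0 := by
    refine ae_eq_zero_of_integral_contDiff_smul_eq_zero (hg.sub (locallyIntegrable_const c)) ?_
    intro φ hφ hφc
    -- Subtracting `(∫ φ) ρ` makes the mean zero, so the result is the derivative of a test
    -- function.
    obtain ⟨η, h1, h2, h3⟩ := exists_contDiff_hasCompactSupport_deriv_eq
      (φ := fun t => φ t - (∫ x, φ x) * ρ t) (hφ.sub (contDiff_const.mul hρ))
      (hφc.sub hρc.mul_left)
      (by rw [integral_sub (hint φ hφ hφc) ((hint ρ hρ hρc).const_mul _), integral_const_mul, hρ1,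
        mul_one, sub_self])
    have h4 := h η h1 h2
    simp only [h3, sub_smul, mul_smul] at h4
    rw [integral_sub (hintg φ hφ hφc) (hρg (∫ x, φ x)),
      integral_smul] at h4
    simp only [smul_sub]
    rw [integral_sub (hintg φ hφ hφc) ((hint φ hφ hφc).smul_const c), integral_smul_const]
    exact h4
  filter_upwards [key] with t ht using sub_eq_zero.1 ht

/-- Mean value inequality for `x ↦ η x - x η'(t)`, with `η'` Lipschitz. The bound is uniform in `t`
and still tends to zero after division by `σ`. -/
theorem exists_norm_sub_add_deriv_le {η : ℝ → ℂ} (hη : ContDiff ℝ ∞ η)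
    (hc : HasCompactSupport η) :
    ∃ C : ℝ, 0 ≤ C ∧ ∀ t σ : ℝ, ‖η (t - σ) - η t + (σ : ℂ) * deriv η t‖ ≤ C * |σ| * |σ| := by
  obtain ⟨C, hC⟩ := ContDiff.lipschitzWith_of_hasCompactSupport (𝕂 := ℝ) hc.deriv
    (contDiff_infty_iff_deriv.1 hη).2 (by simp)
  refine ⟨C, C.2, fun t σ => ?_⟩
  have hd : ∀ x ∈ Set.uIcc t (t - σ),
      HasDerivWithinAt (fun x : ℝ => η x - (x : ℂ) * deriv η t) (deriv η x - 1 * deriv η t)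
        (Set.uIcc t (t - σ)) x := fun x _ =>
    (((hη.differentiable (by simp)) x).hasDerivAt.sub
      (Complex.ofRealCLM.hasDerivAt.mul_const (deriv η t))).hasDerivWithinAt
  have := Convex.norm_image_sub_le_of_norm_hasDerivWithin_le (C := C * |σ|) hd (fun x hx => ?_)
    (convex_uIcc _ _) Set.left_mem_uIcc Set.right_mem_uIcc
  · have h1 : η (t - σ) - ((t - σ : ℝ) : ℂ) * deriv η t - (η t - (t : ℂ) * deriv η t) =
        η (t - σ) - η t + (σ : ℂ) * deriv η t := by
      push_cast
      ring
    have h2 : ‖t - σ - t‖ = |σ| := by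
      rw [sub_sub_cancel_left, norm_neg, Real.norm_eq_abs]
    rwa [h1, h2] at this
  · rw [one_mul, ← dist_eq_norm]
    refine (hC.dist_le_mul _ _).trans (mul_le_mul_of_nonneg_left ?_ C.2)
    rw [Real.dist_eq]
    simpa using Set.abs_sub_left_of_mem_uIcc hx

/-! ### Generators and an L² estimate. -/

section Generator

variable {E : Type*} [NormedAddCommGroup E] [NormedSpace ℂ E] (T : ℝ → (E →ₗᵢ[ℂ] E))

theorem stoneGenerator_tendsto (f : (stoneGenerator T).domain) :
    Tendsto (fun σ : ℝ => (Complex.I / (σ : ℂ)) • (T σ f - f)) (𝓝[≠] 0)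
      (𝓝 (stoneGenerator T f)) :=
  f.2.choose_spec

theorem exists_stoneGenerator_eq {f g : E}
    (h : Tendsto (fun σ : ℝ => (Complex.I / (σ : ℂ)) • (T σ f - f)) (𝓝[≠] 0) (𝓝 g)) :
    ∃ F : (stoneGenerator T).domain, (F : E) = f ∧ stoneGenerator T F = g :=
  ⟨⟨f, g, h⟩, rfl, tendsto_nhds_unique (stoneGenerator_tendsto T ⟨f, g, h⟩) h⟩

end Generator

/-- Cauchy-Schwarz on `S`. Only norms are compared, so `k` may be `h` twisted pointwise by
unitaries. -/
theorem norm_setIntegral_le_mul_norm {H : Type*} [NormedAddCommGroup H] [NormedSpace ℝ H]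
    {S : Set ℝ} (hS : volume S ≠ ⊤) (h : Lp H 2 (volume : Measure ℝ)) {k : ℝ → H}
    (hk : ∀ᵐ t, ‖k t‖ = ‖h t‖) :
    ‖∫ t in S, k t‖ ≤ ‖h‖ * (volume S ^ (1 / 2 : ℝ)).toReal := by
  have : IsFiniteMeasure (volume.restrict S) := ⟨by simpa using hS.lt_top⟩
  have hfin : volume S ^ (1 / 2 : ℝ) ≠ ⊤ := ENNReal.rpow_ne_top_of_nonneg (by norm_num) hS
  calc ‖∫ t in S, k t‖ ≤ ∫ t in S, ‖k t‖ := norm_integral_le_integral_norm _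
    _ = ∫ t in S, ‖h t‖ := integral_congr_ae (ae_restrict_of_ae hk)
    _ = (eLpNorm h 1 (volume.restrict S)).toReal := by
        rw [integral_norm_eq_lintegral_enorm (Lp.aestronglyMeasurable h).restrict,
          eLpNorm_one_eq_lintegral_enorm]
    _ ≤ (eLpNorm h 2 volume * volume S ^ (1 / 2 : ℝ)).toReal := by
        refine ENNReal.toReal_mono (ENNReal.mul_ne_top (Lp.eLpNorm_ne_top h) hfin) ?_
        refine (eLpNorm_le_eLpNorm_mul_rpow_measure_univ (p := 1) (q := 2) (by norm_num)
          (Lp.aestronglyMeasurable h).restrict).trans ?_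
        rw [Measure.restrict_apply_univ]
        refine mul_le_mul' (eLpNorm_mono_measure _ Measure.restrict_le_self) (le_of_eq ?_)
        congr 1
        norm_num
    _ = _ := by rw [ENNReal.toReal_mul, Lp.norm_def]

/-! ### Trajectories lie in the generalized kernel. -/

namespace Propagator

variable {H : Type*} [NormedAddCommGroup H] [InnerProductSpace ℂ H]

theorem op_self (U : Propagator H) (t : ℝ) (ψ : H) : U.op t t ψ = ψ :=
  (U.op t t).injective (U.chapman_kolmogorov t t t ψ)

theorem coeFn_shiftGroup (U : Propagator H) (σ : ℝ) (f : Lp H 2 (volume : Measure ℝ)) :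
    U.shiftGroup σ f =ᵐ[volume] fun t => U.op t (t - σ) (f (t - σ)) :=
  (U.memLp_shift σ f).coeFn_toLp

theorem coeFn_trajectory (U : Propagator H) (ψ : H) :
    U.trajectory ψ =ᵐ[volume] fun t => U.op t 0 ψ :=
  AEEqFun.coeFn_mk _ _

theorem continuous_trajectory (U : Propagator H) (ψ : H) : Continuous fun t => U.op t 0 ψ :=
  (U.strong_cont ψ).comp (Continuous.prodMk_left 0)

theorem memLp_smul_trajectory (U : Propagator H) (ψ : H) {η : ℝ → ℂ} (hη : Continuous η)
    (hc : HasCompactSupport η) : MemLp (fun t => η t • U.op t 0 ψ) 2 volume :=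
  (hη.smul (U.continuous_trajectory ψ)).memLp_of_hasCompactSupport hc.smul_right

/-- The difference quotient of the shifted and the original `f`, minus the limit `g`. -/
theorem coeFn_quotient (U : Propagator H) {f g : Lp H 2 (volume : Measure ℝ)} (σ : ℝ)
    {u v : ℝ → H} (hf : f =ᵐ[volume] u) (hg : g =ᵐ[volume] v) :
    ((Complex.I / (σ : ℂ)) • (U.shiftGroup σ f - f) - g : Lp H 2 (volume : Measure ℝ))
      =ᵐ[volume] fun t =>
        (Complex.I / (σ : ℂ)) • (U.op t (t - σ) (u (t - σ)) - u t) - v t := by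
  filter_upwards [Lp.coeFn_sub ((Complex.I / (σ : ℂ)) • (U.shiftGroup σ f - f)) g,
    Lp.coeFn_smul (Complex.I / (σ : ℂ)) (U.shiftGroup σ f - f),
    Lp.coeFn_sub (U.shiftGroup σ f) f, U.coeFn_shiftGroup σ f, hf, hg,
    (measurePreserving_sub_right volume σ).quasiMeasurePreserving.ae hf] with
    t h1 h2 h3 h4 h5 h6 h7
  rw [h1, Pi.sub_apply, h2, Pi.smul_apply, h3, Pi.sub_apply, h4, h5, h6, h7]

theorem exists_quasiEnergy_smul_trajectory (U : Propagator H) (ψ : H) {η : ℝ → ℂ}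
    (hη : ContDiff ℝ ∞ η) (hc : HasCompactSupport η) :
    ∃ F : U.quasiEnergy.domain,
      ((F : Lp H 2 (volume : Measure ℝ)) : ℝ → H) =ᵐ[volume] (fun t => η t • U.op t 0 ψ) ∧
      (U.quasiEnergy F : ℝ → H) =ᵐ[volume]
        fun t => (-Complex.I * deriv η t) • U.op t 0 ψ := by
  have hη' : Continuous (deriv η) := (contDiff_infty_iff_deriv.1 hη).2.continuous
  have hm := U.memLp_smul_trajectory ψ hη.continuous hc
  have hm' : MemLp (fun t => (-Complex.I * deriv η t) • U.op t 0 ψ) 2 volume :=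
    U.memLp_smul_trajectory ψ (continuous_const.mul hη') hc.deriv.mul_left
  obtain ⟨C, hC0, hC⟩ := exists_norm_sub_add_deriv_le hη hc
  -- A fixed compact set containing the supports of all shifts of `η` with `|σ| ≤ 1`.
  let S : Set ℝ := Metric.cthickening 1 (tsupport η)
  have hS : IsCompact S := hc.isCompact.cthickening
  have hzero : ∀ t σ : ℝ, |σ| ≤ 1 → t ∉ S → η (t - σ) = 0 := fun t σ hσ ht => by
    by_contra h
    refine ht (Metric.mem_cthickening_of_dist_le t (t - σ) 1 _ (subset_tsupport η h) ?_)
    simpa [Real.dist_eq] using hσ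
  have hzero' : ∀ t, t ∉ S → deriv η t = 0 := fun t ht => by
    by_contra h
    exact ht (Metric.self_subset_cthickening _ (support_deriv_subset h))
  let B : Lp ℝ 2 (volume : Measure ℝ) :=
    indicatorConstLp 2 hS.measurableSet hS.measure_ne_top (C * ‖ψ‖)
  suffices h : Tendsto (fun σ : ℝ => (Complex.I / (σ : ℂ)) • (U.shiftGroup σ (hm.toLp _) -
      hm.toLp _)) (𝓝[≠] 0) (𝓝 (hm'.toLp _)) by
    obtain ⟨F, h1, h2⟩ := exists_stoneGenerator_eq U.shiftGroup h
    have h3 : U.quasiEnergy F = hm'.toLp _ := h2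
    exact ⟨F, h1 ▸ hm.coeFn_toLp, h3 ▸ hm'.coeFn_toLp⟩
  rw [tendsto_iff_norm_sub_tendsto_zero]
  have hlim : Tendsto (fun σ : ℝ => |σ| * ‖B‖) (𝓝[≠] 0) (𝓝 0) := by
    have : Continuous fun σ : ℝ => |σ| * ‖B‖ := by fun_prop
    simpa using (this.tendsto 0).mono_left nhdsWithin_le_nhds
  refine squeeze_zero' (Eventually.of_forall fun _ => norm_nonneg _) ?_ hlim
  have hsmall : ∀ᶠ σ : ℝ in 𝓝[≠] 0, |σ| ≤ 1 := nhdsWithin_le_nhds <| by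
    filter_upwards [Metric.closedBall_mem_nhds (0 : ℝ) one_pos] with σ hσ
    simpa using hσ
  filter_upwards [hsmall, self_mem_nhdsWithin] with σ hσ hσ0
  have hσ0' : (σ : ℂ) ≠ 0 := by simpa using hσ0
  refine Lp.norm_le_mul_norm_of_ae_le_mul ?_
  filter_upwards [U.coeFn_quotient σ hm.coeFn_toLp hm'.coeFn_toLp,
    indicatorConstLp_coeFn (p := 2) (hs := hS.measurableSet) (hμs := hS.measure_ne_top)
      (c := C * ‖ψ‖)] with t h1 h2
  -- Chapman-Kolmogorov factors out `U(t,0)ψ`, leaving a scalar Taylor remainder.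
  have h3 : (Complex.I / (σ : ℂ)) • (U.op t (t - σ) (η (t - σ) • U.op (t - σ) 0 ψ) -
      η t • U.op t 0 ψ) - (-Complex.I * deriv η t) • U.op t 0 ψ =
      ((Complex.I / (σ : ℂ)) * (η (t - σ) - η t + σ * deriv η t)) • U.op t 0 ψ := by
    rw [map_smul, U.chapman_kolmogorov, ← sub_smul, smul_smul, ← sub_smul]
    congr 1
    field_simp
    ring
  rw [h1, h3, h2]
  by_cases ht : t ∈ S
  · rw [Set.indicator_of_mem ht, norm_smul, LinearIsometryEquiv.norm_map, norm_mul, norm_div,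
      Complex.norm_I, Complex.norm_real, Real.norm_eq_abs,
      Real.norm_of_nonneg (mul_nonneg hC0 (norm_nonneg ψ))]
    have hpos : 0 < |σ| := abs_pos.2 hσ0
    calc 1 / |σ| * ‖η (t - σ) - η t + σ * deriv η t‖ * ‖ψ‖
        ≤ 1 / |σ| * (C * |σ| * |σ|) * ‖ψ‖ := by gcongr; exact hC t σ
      _ = |σ| * (C * ‖ψ‖) := by field_simp
  · have h0 := hzero t 0 (by simp) ht
    rw [sub_zero] at h0
    rw [hzero t σ hσ ht, h0, hzero' t ht, Set.indicator_of_notMem ht]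
    simp

theorem trajectory_mem_generalizedKernel (U : Propagator H) (ψ : H) :
    U.trajectory ψ ∈ generalizedKernel U.quasiEnergy := by
  refine ⟨fun S hS => ?_, fun η hη hc => ?_⟩
  · have : IsFiniteMeasure (volume.restrict S) := ⟨by simpa using hS.measure_lt_top⟩
    refine MemLp.of_bound (U.trajectory ψ).aestronglyMeasurable.restrict ‖ψ‖
      (ae_restrict_of_ae ?_)
    filter_upwards [U.coeFn_trajectory ψ] with t ht
    rw [ht, LinearIsometryEquiv.norm_map]
  · obtain ⟨F, h1, h2⟩ := U.exists_quasiEnergy_smul_trajectory ψ hη hc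
    refine ⟨F, h1.trans ?_, h2.trans ?_⟩ <;>
      filter_upwards [U.coeFn_trajectory ψ] with t ht <;> rw [ht]

/-! ### Kernel elements are trajectories. -/

theorem locallyIntegrable_pullback (U : Propagator H) {f : ℝ →ₘ[(volume : Measure ℝ)] H}
    (hf : f ∈ L2loc H) : LocallyIntegrable (fun t => U.op 0 t (f t)) volume := by
  rw [locallyIntegrable_iff]
  intro S hS
  have : IsFiniteMeasure (volume.restrict S) := ⟨by simpa using hS.measure_lt_top⟩
  have hfi : Integrable f (volume.restrict S) := (hf S hS).integrable (by norm_num)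
  refine hfi.mono ?_ (Eventually.of_forall fun t => by simp)
  exact U.continuous_uncurry.comp_aestronglyMeasurable <| AEStronglyMeasurable.prodMk
    (by fun_prop : Continuous fun t : ℝ => ((0, t) : ℝ × ℝ)).aestronglyMeasurable hfi.1

theorem integral_deriv_smul_pullback (U : Propagator H) {f : ℝ →ₘ[(volume : Measure ℝ)] H}
    (hf : f ∈ generalizedKernel U.quasiEnergy) {η : ℝ → ℂ} (hη : ContDiff ℝ ∞ η)
    (hc : HasCompactSupport η) : ∫ t, deriv η t • U.op 0 t (f t) = 0 := by
  obtain ⟨F, hF, hKF⟩ := hf.2 η hη hc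
  have hη' : Continuous (deriv η) := (contDiff_infty_iff_deriv.1 hη).2.continuous
  have hg := U.locallyIntegrable_pullback hf.1
  set g : ℝ → H := fun t => U.op 0 t (f t) with hgdef
  have hp : Integrable fun t => η t • g t :=
    hg.integrable_smul_left_of_hasCompactSupport hη.continuous hc
  have hq : Integrable fun t => deriv η t • g t :=
    hg.integrable_smul_left_of_hasCompactSupport hη' hc.deriv
  let S : Set ℝ := Metric.cthickening 1 (tsupport η)
  have hS : IsCompact S := hc.isCompact.cthickening
  have hzero : ∀ t σ : ℝ, |σ| ≤ 1 → t ∉ S → η (t - σ) = 0 := fun t σ hσ ht => by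
    by_contra h
    refine ht (Metric.mem_cthickening_of_dist_le t (t - σ) 1 _ (subset_tsupport η h) ?_)
    simpa [Real.dist_eq] using hσ
  have hzero' : ∀ t, t ∉ S → deriv η t = 0 := fun t ht => by
    by_contra h
    exact ht (Metric.self_subset_cthickening _ (support_deriv_subset h))
  have hT := tendsto_iff_norm_sub_tendsto_zero.1 (stoneGenerator_tendsto U.shiftGroup F)
  have hlim := hT.mul_const (volume S ^ (1 / 2 : ℝ)).toReal
  rw [zero_mul] at hlim
  have hsmall : ∀ᶠ σ : ℝ in 𝓝[≠] 0, |σ| ≤ 1 := nhdsWithin_le_nhds <| by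
    filter_upwards [Metric.closedBall_mem_nhds (0 : ℝ) one_pos] with σ hσ
    simpa using hσ
  rw [← norm_le_zero_iff]
  refine ge_of_tendsto hlim ?_
  filter_upwards [hsmall] with σ hσ
  have h1 := U.coeFn_quotient σ hF hKF
  -- The isometry `U(0,t)` turns the quotient into that of the translates of `ηg`.
  have hk : ∀ᵐ t, ‖(Complex.I / (σ : ℂ)) • (η (t - σ) • g (t - σ) - η t • g t) +
      Complex.I • deriv η t • g t‖ = ‖((Complex.I / (σ : ℂ)) • (U.shiftGroup σ F - F) -
        stoneGenerator U.shiftGroup F : Lp H 2 (volume : Measure ℝ)) t‖ := by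
    filter_upwards [h1] with t ht
    refine Eq.trans ?_ (((U.op 0 t).norm_map _).trans (congrArg norm ht).symm)
    congr 1
    simp only [map_sub, map_smul, U.chapman_kolmogorov, hgdef]
    rw [neg_mul, neg_smul, sub_neg_eq_add, mul_smul]
  have hle := norm_setIntegral_le_mul_norm hS.measure_ne_top _ hk
  -- Translation invariance cancels the difference quotient, leaving only `i ∫ η' g`.
  rw [setIntegral_eq_integral_of_forall_compl_eq_zero, integral_add, integral_smul, integral_smul,
    integral_sub (hp.comp_sub_right σ) hp,
    integral_sub_right_eq_self (fun t => η t • g t) σ, sub_self, smul_zero, zero_add, norm_smul,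
    Complex.norm_I, one_mul] at hle
  · exact hle
  · exact ((hp.comp_sub_right σ).sub hp).smul _
  · exact hq.smul _
  · intro t ht
    have h0 := hzero t 0 (by simp) ht
    rw [sub_zero] at h0
    rw [hzero t σ hσ ht, h0, hzero' t ht]
    simp

theorem generalizedKernel_quasiEnergy [CompleteSpace H] (U : Propagator H) :
    generalizedKernel U.quasiEnergy = Set.range fun ψ : H => U.trajectory ψ := by
  refine Set.Subset.antisymm (fun f hf => ?_) ?_
  · obtain ⟨ψ, hψ⟩ := ae_eq_const_of_integral_deriv_smul_eq_zero
      (U.locallyIntegrable_pullback hf.1) fun η hη hc => by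
        have hd : ∀ t, deriv (fun t => (η t : ℂ)) t = ((deriv η t : ℝ) : ℂ) := fun t =>
          ((hη.differentiable (by simp)) t).hasDerivAt.ofReal_comp.deriv
        have := U.integral_deriv_smul_pullback hf (η := fun t => (η t : ℂ))
          (Complex.ofRealCLM.contDiff.comp hη) (hc.comp_left Complex.ofReal_zero)
        simpa only [hd, Complex.coe_smul] using this
    refine ⟨ψ, AEEqFun.ext ((U.coeFn_trajectory ψ).trans ?_)⟩
    filter_upwards [hψ] with t ht
    rw [← ht, U.chapman_kolmogorov, U.op_self]
  · rintro _ ⟨ψ, rfl⟩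
    exact U.trajectory_mem_generalizedKernel ψ

/-! ### Uniqueness of the propagator. -/

theorem ext_of_op_zero {U V : Propagator H} (h : ∀ t ψ, U.op t 0 ψ = V.op t 0 ψ) : U = V := by
  ext t s ψ
  have h0 : U.op 0 s ψ = V.op 0 s ψ := (U.op s 0).injective <| by
    rw [U.chapman_kolmogorov, U.op_self, h, V.chapman_kolmogorov, V.op_self]
  rw [← U.chapman_kolmogorov t s 0, ← V.chapman_kolmogorov t s 0, h0, h]

theorem quasiEnergy_injective [CompleteSpace H] :
    Function.Injective (quasiEnergy : Propagator H →
      (Lp H 2 (volume : Measure ℝ) →ₗ.[ℂ] Lp H 2 (volume : Measure ℝ))) := by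
  intro U V hUV
  refine ext_of_op_zero fun t ψ => ?_
  have hmem : U.trajectory ψ ∈ Set.range fun φ : H => V.trajectory φ := by
    rw [← V.generalizedKernel_quasiEnergy, ← hUV]
    exact U.trajectory_mem_generalizedKernel ψ
  obtain ⟨φ, hφ : V.trajectory φ = U.trajectory ψ⟩ := hmem
  have hae : (fun t => U.op t 0 ψ) =ᵐ[volume] fun t => V.op t 0 φ :=
    (U.coeFn_trajectory ψ).symm.trans (hφ ▸ V.coeFn_trajectory φ)
  have heq := (Continuous.ae_eq_iff_eq volume (U.continuous_trajectory ψ)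
    (V.continuous_trajectory φ)).1 hae
  have h0 : ψ = φ := by simpa only [op_self] using congrFun heq 0
  rw [h0] at heq ⊢
  exact congrFun heq t

end Propagator

theorem mainTheorem7 {H : Type*} [NormedAddCommGroup H] [InnerProductSpace ℂ H]
    [CompleteSpace H] [TopologicalSpace.SeparableSpace H] :
    (∀ U : Propagator H,
      generalizedKernel U.quasiEnergy = Set.range fun ψ : H => U.trajectory ψ) ∧
    Function.Injective (Propagator.quasiEnergy :
      Propagator H →
        (Lp H 2 (volume : Measure ℝ) →ₗ.[ℂ] Lp H 2 (volume : Measure ℝ))) :=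
  ⟨fun U => U.generalizedKernel_quasiEnergy, Propagator.quasiEnergy_injective⟩
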